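/- Let $(X,\mathcal F,\mu)$ be a probability space and let $T:X\to X$ be a measurable transformation that preserves $\mu$. Write $\mathbb N=\{1,2,3,\dots\}$. Let $(f_n)_{n\in\mathbb N}$ be measurable functions on $X$ with values in $[-\infty,\infty)$ whose positive parts $f_{n,+}$ belong to $L^1(\mathrm d\mu)$ for all $n$. Suppose that there are a sequence $(\sigma_n)_{n\in\mathbb N}$ of nonnegative integers with $\sigma_1=0$ and $\sigma_n=o(n)$, and a sequence $(\rho_n)_{n\in\mathbb N}$ of nonnegative functions in $L^1(\mathrm d\mu)$, such that $$f_{n+\sigma_n+m}\le f_n+\rho_n+f_m\circ T^{\,n+\sigma_n}\quad \mu\text{-almost surely, for all } n,m\in\mathbb N,$$ such that $\lim_{n\to\infty}\frac{\rho_n}{n}=0$ $\mu$-almost surely, and such that $\lim_{n\to\infty}\frac1n\int\rho_n\,\mathrm d\mu=0$. Then the limit $f=\lim_{n\to\infty}\frac{f_n}{n}$ exists $\mu$-almost surely, its positive part $f_+$ is in $L^1(\mathrm d\mu)$, and $$\lim_{n\to\infty}\frac1n\int f_n\,\mathrm d\mu=\int f\,\mathrm d\mu,$$ where the integrals and the limit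 are understood in $[-\infty,\infty)$. -/

import Mathlib

open Filter Topology MeasureTheory Asymptotics

/-- The integral `∫ g₊ dμ` of the positive part of a function with values in `[-∞, ∞]`. -/
noncomputable def posPartIntegral {X : Type*} [MeasurableSpace X] (μ : Measure X)
    (g : X → EReal) : ENNReal :=
  ∫⁻ x, (g x).toENNReal ∂μ

/-- The integral `∫ g dμ = ∫ g₊ dμ - ∫ g₋ dμ` of a measurable function with values in
`[-∞, ∞]`. It is meaningful, with a value in `[-∞, ∞)`, as soon as `∫ g₊ dμ` is finite. -/
noncomputable def extIntegral {X : Type*} [MeasurableSpace X] (μ : Measure X)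
    (g : X → EReal) : EReal :=
  (posPartIntegral μ g : EReal) - (posPartIntegral μ (fun x => -g x) : EReal)

/-!
The proof reduces to nonnegative functions and then follows the covering argument for Kingman's
theorem; Birkhoff's theorem is not used.

*Reduction.* For `M : ℕ`, the functions `max (f n) (-M * n) + M * n = (f n + M * n)₊` are again
gapped subadditive, with errors `ρ n + M * σ n`, which are still `o(n)` since `σ n = o(n)`
(`gappedSubadditive_truncation`). They take values in `[0, ∞]`, so no cancellation occurs.

*Nonnegative case.* Let `L = liminf f n / n` and `g = f 1 + ρ 1`. Since `σ 1 = 0`, single steps are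
allowed: `f (m + 1) ≤ g + f m ∘ T`. Hence `L ≤ L ∘ T`, and `L` is invariant because `∫ L` is finite
(`liminf_comp_ae_eq`). For almost every `x` some `n` satisfies `f n x + ρ n x ≤ n * (L x + ε)`; let
the bad set consist of the points that have no such `n ≤ K`. An orbit segment of length `N` is
filled greedily: a good point starts a block of length `n + σ n`, and a bad point, or a point among
the last boundedly many, is passed in a single step. This gives (`le_of_blocks`)
`f N x ≤ N * (L x + ε) + (sum of g over visits to the bad set) + (sum of g over the last steps)`.
The last sum is `o(N)` almost everywhere by Borel-Cantelli, and the middle one is controlled by the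
maximal inequality (`maximal_inequality`), because the integral of `g` over the bad set tends to `0`
as `K → ∞`. So `limsup f n / n ≤ L` almost everywhere (`ae_tendsto`). Integrating the same bound
gives `limsup (∫ f n) / n ≤ ∫ L`, and Fatou's lemma gives the converse (`tendsto_lintegral`).

*Back to `[-∞, ∞)`.* Convergence of all truncations gives almost everywhere convergence to some
`F`. For the integrals, each truncated integral bounds `∫ f n` from above. From below, iterating
the inequality with a fixed `n` gives `(n + σ n) * ∫ L ≤ ∫ f n + ∫ ρ n` at each level `M`
(`mul_lintegral_liminf_le`); the shift by `M` cancels, and `M → ∞` is then possible for fixed `n`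
(`tendsto_div_of_truncation`). This last step is where the means of `ρ n` are used.
-/

open scoped ENNReal

/-! ### Birkhoff sums and the maximal inequality -/

lemma birkhoffSum_mono_length {X : Type*} (T : X → X) (h : X → ℝ≥0∞) {m n : ℕ} (hmn : m ≤ n)
    (x : X) : birkhoffSum T h m x ≤ birkhoffSum T h n x :=
  Finset.sum_le_sum_of_subset (Finset.range_mono hmn)

lemma birkhoffSum_mono_fun {X : Type*} (T : X → X) {h h' : X → ℝ≥0∞} (hh : ∀ x, h x ≤ h' x)
    (n : ℕ) (x : X) : birkhoffSum T h n x ≤ birkhoffSum T h' n x :=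
  Finset.sum_le_sum fun _ _ => hh _

lemma lintegral_birkhoffSum {X : Type*} [MeasurableSpace X] {μ : Measure X} {T : X → X}
    (hT : MeasurePreserving T μ μ) {h : X → ℝ≥0∞} (hh : Measurable h) (n : ℕ) :
    ∫⁻ x, birkhoffSum T h n x ∂μ = n * ∫⁻ x, h x ∂μ := by
  unfold birkhoffSum
  rw [lintegral_finsetSum (Finset.range n) (f := fun k x => h (T^[k] x))
    fun k _ => hh.comp (hT.iterate k).measurable]
  simp [fun k => (hT.iterate k).lintegral_comp hh]

lemma measurable_birkhoffSum {X : Type*} [MeasurableSpace X] {T : X → X}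
    (hT : Measurable T) {h : X → ℝ≥0∞} (hh : Measurable h) (n : ℕ) :
    Measurable (birkhoffSum T h n) :=
  Finset.measurable_fun_sum _ fun k _ => hh.comp (hT.iterate k)

/-- Covering step of the maximal inequality: the visits to `E` before time `N` are covered by
disjoint time intervals of length at most `K` on each of which the average of `h` is at least
`c`. -/
lemma mul_birkhoffSum_indicator_le {X : Type*} (T : X → X) (h : X → ℝ≥0∞) (E : Set X) (K : ℕ)
    (c : ℝ≥0∞) (hE : ∀ x ∈ E, ∃ n, 1 ≤ n ∧ n ≤ K ∧ c * n ≤ birkhoffSum T h n x) (N : ℕ) (x : X) :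
    c * birkhoffSum T (E.indicator 1) N x ≤ birkhoffSum T h (N + K) x := by
  have hcount : ∀ (n : ℕ) (y : X), birkhoffSum T (E.indicator 1) n y ≤ (n : ℝ≥0∞) := by
    intro n y
    refine (birkhoffSum_mono_fun T (h' := fun _ => 1)
      (fun z => Set.indicator_le_self' (by simp) z) n y).trans ?_
    simp [birkhoffSum]
  induction N using Nat.strong_induction_on generalizing x with
  | _ N ih =>
    rcases Nat.eq_zero_or_pos N with rfl | hN
    · simp
    by_cases hx : x ∈ E
    · obtain ⟨n, hn1, hnK, hn⟩ := hE x hx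
      rcases le_or_gt N n with hNn | hnN
      · calc c * birkhoffSum T (E.indicator 1) N x ≤ c * n := by
              gcongr
              exact (hcount N x).trans (by exact_mod_cast hNn)
          _ ≤ birkhoffSum T h n x := hn
          _ ≤ _ := birkhoffSum_mono_length T h (by omega) x
      · obtain ⟨m, rfl⟩ := Nat.exists_eq_add_of_lt hnN
        rw [show n + m + 1 = n + (m + 1) by ring, birkhoffSum_add T _ n (m + 1),
          show n + (m + 1) + K = n + (m + 1 + K) by ring, birkhoffSum_add T h n (m + 1 + K),
          mul_add]
        exact add_le_add ((mul_le_mul_right (hcount n x) c).trans hn) (ih (m + 1) (by omega) _)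
    · obtain ⟨m, rfl⟩ := Nat.exists_eq_succ_of_ne_zero hN.ne'
      rw [Nat.succ_eq_add_one, birkhoffSum_succ', Set.indicator_of_notMem hx, zero_add]
      refine (ih m (by omega) (T x)).trans ?_
      rw [show m + 1 + K = (m + K) + 1 by ring, birkhoffSum_succ']
      exact le_add_self

/-- Integrating the covering bound up to time `N` and letting `N → ∞` makes the `K` extra steps
negligible. -/
lemma maximal_inequality_finite {X : Type*} [MeasurableSpace X] {μ : Measure X}
    [IsProbabilityMeasure μ] {T : X → X} (hT : MeasurePreserving T μ μ) {h : X → ℝ≥0∞}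
    (hh : Measurable h) (c : ℝ≥0∞) (K : ℕ) :
    c * μ {x | ∃ n, 1 ≤ n ∧ n ≤ K ∧ c * n ≤ birkhoffSum T h n x} ≤ ∫⁻ x, h x ∂μ := by
  set E := {x | ∃ n, 1 ≤ n ∧ n ≤ K ∧ c * n ≤ birkhoffSum T h n x} with hEdef
  have hEm : MeasurableSet E := by
    have : E = ⋃ n, ⋃ (_ : 1 ≤ n ∧ n ≤ K), {x | c * n ≤ birkhoffSum T h n x} := by
      ext x; simp [hEdef, and_assoc]
    rw [this]
    exact .iUnion fun n => .iUnion fun _ =>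
      measurableSet_le measurable_const (measurable_birkhoffSum hT.measurable hh n)
  have key : ∀ N : ℕ, (N : ℝ≥0∞) * (c * μ E) ≤ (N + K) * ∫⁻ x, h x ∂μ := by
    intro N
    have := lintegral_mono (μ := μ) (mul_birkhoffSum_indicator_le T h E K c (fun x hx => hx) N)
    rw [lintegral_const_mul _ (measurable_birkhoffSum hT.measurable (measurable_one.indicator hEm) N),
      lintegral_birkhoffSum hT (measurable_one.indicator hEm), lintegral_birkhoffSum hT hh,
      lintegral_indicator_one hEm] at this
    push_cast at this
    calc _ = _ := by ring
      _ ≤ _ := this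
  have hlim : Tendsto (fun N : ℕ => (1 + (K : ℝ≥0∞) / N) * ∫⁻ x, h x ∂μ) atTop
      (𝓝 ((1 + 0) * ∫⁻ x, h x ∂μ)) := by
    refine ENNReal.Tendsto.mul_const (tendsto_const_nhds.add ?_) (Or.inl (by simp))
    exact ENNReal.Tendsto.const_div ENNReal.tendsto_nat_nhds_top (by simp) |>.trans (by simp)
  rw [add_zero, one_mul] at hlim
  refine ge_of_tendsto hlim ?_
  filter_upwards [eventually_ge_atTop 1] with N hN
  have hN0 : (N : ℝ≥0∞) ≠ 0 := by simp; omega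
  have hNt : (N : ℝ≥0∞) ≠ ⊤ := by simp
  rw [← ENNReal.mul_le_mul_iff_right hN0 hNt]
  refine (key N).trans_eq ?_
  rw [← mul_assoc, mul_add, mul_one, ENNReal.mul_div_cancel hN0 hNt]

/-- The maximal ergodic inequality (in weak type form) for nonnegative functions. -/
lemma maximal_inequality {X : Type*} [MeasurableSpace X] {μ : Measure X}
    [IsProbabilityMeasure μ] {T : X → X} (hT : MeasurePreserving T μ μ) {h : X → ℝ≥0∞}
    (hh : Measurable h) (c : ℝ≥0∞) :
    c * μ {x | ∃ n : ℕ, 1 ≤ n ∧ c * n ≤ birkhoffSum T h n x} ≤ ∫⁻ x, h x ∂μ := by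
  have hU : {x | ∃ n : ℕ, 1 ≤ n ∧ c * n ≤ birkhoffSum T h n x}
      = ⋃ K : ℕ, {x | ∃ n, 1 ≤ n ∧ n ≤ K ∧ c * n ≤ birkhoffSum T h n x} := by
    ext x
    simp only [Set.mem_ofPred_eq, Set.mem_iUnion]
    exact ⟨fun ⟨n, h1, h2⟩ => ⟨n, n, h1, le_rfl, h2⟩, fun ⟨_, n, h1, _, h2⟩ => ⟨n, h1, h2⟩⟩
  have hmono : Monotone fun K : ℕ => {x | ∃ n, 1 ≤ n ∧ n ≤ K ∧ c * n ≤ birkhoffSum T h n x} :=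
    fun K K' hK x ⟨n, h1, h2, h3⟩ => ⟨n, h1, h2.trans hK, h3⟩
  rw [hU, hmono.measure_iUnion, ENNReal.mul_iSup]
  exact iSup_le fun K => maximal_inequality_finite hT hh c K

/-- Along almost every orbit an integrable function grows sublinearly (Borel-Cantelli). -/
lemma ae_eventually_comp_iterate_le {X : Type*} [MeasurableSpace X] {μ : Measure X}
    [IsProbabilityMeasure μ] {T : X → X} (hT : MeasurePreserving T μ μ) {g : X → ℝ≥0∞}
    (hg : Measurable g) (hgi : ∫⁻ x, g x ∂μ ≠ ⊤) (δ : ℝ≥0∞) (hδ : δ ≠ 0) :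
    ∀ᵐ x ∂μ, ∀ᶠ k : ℕ in atTop, g (T^[k] x) ≤ δ * k := by
  wlog hδt : δ ≠ ⊤ generalizing δ
  · filter_upwards [this 1 (by simp) (by simp)] with x hx
    filter_upwards [hx] with k hk
    exact hk.trans (by gcongr; simp [not_not.mp hδt])
  have hi : ∫⁻ x, g x / δ ∂μ ≠ ⊤ := by
    simp_rw [div_eq_mul_inv]
    rw [lintegral_mul_const _ hg]
    exact ENNReal.mul_ne_top hgi (by simpa using hδ)
  have hint := integrable_toReal_of_lintegral_ne_top (hg.div_const δ).aemeasurable hi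
  let _ : MeasureSpace X := ⟨μ⟩
  have hs := ProbabilityTheory.tsum_prob_mem_Ioi_lt_top (Ω := X) hint (fun x => by positivity)
  have hlt : ∀ᵐ x ∂μ, g x / δ < ⊤ := ae_lt_top (hg.div_const δ) hi
  -- By invariance of `μ`, the events `δ * k < g ∘ T^[k]` are as likely as `k < g / δ`.
  have hle : ∀ k : ℕ, μ {x | δ * k < g (T^[k] x)} ≤
      μ {x | (g x / δ).toReal ∈ Set.Ioi (k : ℝ)} := by
    intro k
    have : {x | δ * k < g (T^[k] x)} = T^[k] ⁻¹' {x | δ * k < g x} := rfl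
    rw [this, (hT.iterate k).measure_preimage
      (measurableSet_lt measurable_const hg).nullMeasurableSet]
    refine measure_mono_ae ?_
    filter_upwards [hlt] with x hx hx'
    change (k : ℝ) < (g x / δ).toReal
    rw [← ENNReal.toReal_natCast, ENNReal.toReal_lt_toReal (by simp) hx.ne]
    rw [ENNReal.lt_div_iff_mul_lt (Or.inl hδ) (Or.inl hδt), mul_comm]
    exact hx'
  have := ae_eventually_notMem (μ := μ) (s := fun k : ℕ => {x | δ * k < g (T^[k] x)})
    ((ENNReal.tsum_le_tsum hle).trans_lt hs).ne
  filter_upwards [this] with x hx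
  filter_upwards [hx] with k hk
  simpa using hk

/-! ### Nonnegative gapped subadditive sequences -/

/-- A sequence `f` of nonnegative integrable functions that is subadditive along `T` up to gaps
of length `σ n` and errors `ρ n` with `ρ n / n → 0` almost everywhere. The values at the index
`0` play no role, except for measurability. -/
structure GappedSubadditive {X : Type*} [MeasurableSpace X] (μ : Measure X) (T : X → X)
    (f ρ : ℕ → X → ℝ≥0∞) (σ : ℕ → ℕ) : Prop where
  measurePreserving : MeasurePreserving T μ μ
  measurable : ∀ n, Measurable (f n)
  measurable_error : ∀ n, Measurable (ρ n)
  lintegral_ne_top : ∀ n, 1 ≤ n → ∫⁻ x, f n x ∂μ ≠ ⊤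
  lintegral_error_one_ne_top : ∫⁻ x, ρ 1 x ∂μ ≠ ⊤
  gap_one : σ 1 = 0
  le_add : ∀ n m, 1 ≤ n → 1 ≤ m →
    ∀ᵐ x ∂μ, f (n + σ n + m) x ≤ f n x + ρ n x + f m (T^[n + σ n] x)
  tendsto_error : ∀ᵐ x ∂μ, Tendsto (fun n : ℕ => ρ n x / n) atTop (𝓝 0)

/-! ### Blocks along an orbit -/

lemma le_birkhoffSum_of_le_add {X : Type*} {T : X → X} {f : ℕ → X → ℝ≥0∞} {g : X → ℝ≥0∞}
    {A : Set X} (hTA : ∀ x ∈ A, T x ∈ A) (hg : ∀ x ∈ A, f 1 x ≤ g x)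
    (hfg : ∀ x ∈ A, ∀ m, 1 ≤ m → f (m + 1) x ≤ g x + f m (T x)) (N : ℕ) (hN : 1 ≤ N) :
    ∀ x ∈ A, f N x ≤ birkhoffSum T g N x := by
  induction N, hN using Nat.le_induction with
  | base => simpa [birkhoffSum_one] using hg
  | succ m hm ih =>
    intro x hx
    rw [birkhoffSum_succ']
    exact (hfg x hx m hm).trans (add_le_add le_rfl (ih _ (hTA x hx)))

/-- Covering step of the subadditive theorem. Outside `B` one can start a block of length
`n + σ n ≤ K` on which `f` is controlled by `ℓ`; inside `B`, and on the last `K` steps, the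
orbit is followed one step at a time at the cost `g`. -/
lemma le_of_blocks {X : Type*} {T : X → X} {f ρ : ℕ → X → ℝ≥0∞} {σ : ℕ → ℕ} {g ℓ : X → ℝ≥0∞}
    {A B : Set X} {K : ℕ} (hTA : ∀ x ∈ A, T x ∈ A) (hg : ∀ x ∈ A, f 1 x ≤ g x)
    (hfg : ∀ x ∈ A, ∀ m, 1 ≤ m → f (m + 1) x ≤ g x + f m (T x))
    (hℓ : ∀ x ∈ A, ℓ (T x) = ℓ x)
    (hsub : ∀ x ∈ A, ∀ n m, 1 ≤ n → 1 ≤ m →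
      f (n + σ n + m) x ≤ f n x + ρ n x + f m (T^[n + σ n] x))
    (hB : ∀ x ∈ A, x ∉ B → ∃ n, 1 ≤ n ∧ n + σ n ≤ K ∧ f n x + ρ n x ≤ n * ℓ x)
    (N : ℕ) (hN : 1 ≤ N) : ∀ x ∈ A, f N x ≤ N * ℓ x + birkhoffSum T (B.indicator g) N x
      + ∑ k ∈ Finset.Ico (N - K) N, g (T^[k] x) := by
  have hiter : ∀ (p : ℕ), ∀ x ∈ A, T^[p] x ∈ A ∧ ℓ (T^[p] x) = ℓ x := by
    intro p
    induction p with
    | zero => exact fun x hx => ⟨hx, rfl⟩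
    | succ p ih =>
      intro x hx
      obtain ⟨h1, h2⟩ := ih (T x) (hTA x hx)
      exact ⟨h1, h2.trans (hℓ x hx)⟩
  have htail : ∀ (p m : ℕ) (x : X), ∑ k ∈ Finset.Ico (m - K) m, g (T^[k] (T^[p] x))
      ≤ ∑ k ∈ Finset.Ico (p + m - K) (p + m), g (T^[k] x) := by
    intro p m x
    simp_rw [← Function.iterate_add_apply]
    rw [Finset.sum_Ico_add' (fun k => g (T^[k] x)) (m - K) m p]
    exact Finset.sum_le_sum_of_subset (Finset.Ico_subset_Ico (by omega) (by omega))
  induction N using Nat.strong_induction_on with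
  | _ N ih =>
    intro x hx
    rcases le_or_gt N K with hNK | hNK
    · -- For `N ≤ K` the last `K` steps are the whole orbit segment.
      rw [Nat.sub_eq_zero_of_le hNK, ← Finset.range_eq_Ico]
      exact (le_birkhoffSum_of_le_add hTA hg hfg N hN x hx).trans le_add_self
    by_cases hxB : x ∈ B
    -- In `B`: one step, at the cost `g x`. Outside `B`: one block of length `n + σ n < N`.
    · rcases hN.eq_or_lt with rfl | hN1
      · rw [birkhoffSum_one, Set.indicator_of_mem hxB]
        exact (hg x hx).trans (le_add_self.trans le_self_add)
      · obtain ⟨m, rfl⟩ := Nat.exists_eq_add_of_lt hN1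
        have hIH := ih (1 + m) (by omega) (by omega) (T x) (hTA x hx)
        have ht := htail 1 (1 + m) x
        rw [add_comm 1 (1 + m)] at ht
        rw [hℓ x hx] at hIH
        rw [birkhoffSum_succ', Set.indicator_of_mem hxB]
        calc f (1 + m + 1) x ≤ g x + f (1 + m) (T x) := hfg x hx _ (by omega)
          _ ≤ g x + (((1 + m : ℕ) : ℝ≥0∞) * ℓ x + birkhoffSum T (B.indicator g) (1 + m) (T x)
              + ∑ k ∈ Finset.Ico (1 + m + 1 - K) (1 + m + 1), g (T^[k] x)) := by
            gcongr
            exact hIH.trans (add_le_add le_rfl ht)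
          _ = ((1 + m : ℕ) : ℝ≥0∞) * ℓ x + (g x + birkhoffSum T (B.indicator g) (1 + m) (T x))
              + ∑ k ∈ Finset.Ico (1 + m + 1 - K) (1 + m + 1), g (T^[k] x) := by ring
          _ ≤ _ := add_le_add (add_le_add
              (mul_le_mul_left (by exact_mod_cast Nat.le_succ (1 + m)) _) le_rfl) le_rfl
    · obtain ⟨n, hn1, hnK, hn⟩ := hB x hx hxB
      obtain ⟨m, rfl⟩ := Nat.exists_eq_add_of_lt (hnK.trans_lt hNK)
      obtain ⟨hpA, hpℓ⟩ := hiter (n + σ n) x hx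
      have hIH := ih (m + 1) (by omega) (by omega) _ hpA
      have ht := htail (n + σ n) (m + 1) x
      rw [hpℓ] at hIH
      rw [add_assoc (n + σ n) m 1, birkhoffSum_add]
      calc f (n + σ n + (m + 1)) x ≤ f n x + ρ n x + f (m + 1) (T^[n + σ n] x) :=
            hsub x hx n (m + 1) hn1 (by omega)
        _ ≤ n * ℓ x + (((m + 1 : ℕ) : ℝ≥0∞) * ℓ x
              + birkhoffSum T (B.indicator g) (m + 1) (T^[n + σ n] x)
              + ∑ k ∈ Finset.Ico (n + σ n + (m + 1) - K) (n + σ n + (m + 1)), g (T^[k] x)) :=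
            add_le_add hn (hIH.trans (add_le_add le_rfl ht))
        _ = ((n + (m + 1) : ℕ) : ℝ≥0∞) * ℓ x
              + birkhoffSum T (B.indicator g) (m + 1) (T^[n + σ n] x)
              + ∑ k ∈ Finset.Ico (n + σ n + (m + 1) - K) (n + σ n + (m + 1)), g (T^[k] x) := by
            push_cast
            ring
        _ ≤ _ := by
            gcongr
            · omega
            · exact le_add_self

/-! ### Invariance of the lower limit -/

lemma ENNReal.liminf_le_liminf_of_le_add {u v a : ℕ → ℝ≥0∞} (ha : Tendsto a atTop (𝓝 0))
    (h : ∀ᶠ m in atTop, u (m + 1) ≤ a m + v m) : liminf u atTop ≤ liminf v atTop := by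
  refine le_of_forall_gt fun c hc => ?_
  obtain ⟨d, hd, hdc⟩ := exists_between hc
  obtain ⟨e, hde, hec⟩ := exists_between hdc
  have h1 : ∃ᶠ m in atTop, v m < d := frequently_lt_of_liminf_lt (by isBoundedDefault) hd
  have h2 : ∀ᶠ m in atTop, a m < e - d := ha.eventually_lt_const (tsub_pos_of_lt hde)
  rw [← liminf_nat_add u 1]
  refine lt_of_le_of_lt (liminf_le_of_frequently_le' ?_) hec
  refine (h1.and_eventually (h2.and h)).mono fun m ⟨hv, ham, hu⟩ => ?_
  calc u (m + 1) ≤ a m + v m := hu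
    _ ≤ (e - d) + d := add_le_add ham.le hv.le
    _ = e := tsub_add_cancel_of_le hde.le

namespace GappedSubadditive

variable {X : Type*} [MeasurableSpace X] {μ : Measure X} {T : X → X}
  {f ρ : ℕ → X → ℝ≥0∞} {σ : ℕ → ℕ}

lemma ae_iterate (h : GappedSubadditive μ T f ρ σ) {p : X → Prop} (hp : ∀ᵐ x ∂μ, p x) :
    ∀ᵐ x ∂μ, ∀ k : ℕ, p (T^[k] x) :=
  ae_all_iff.2 fun k => (h.measurePreserving.iterate k).quasiMeasurePreserving.ae hp

lemma measurable_base (h : GappedSubadditive μ T f ρ σ) : Measurable fun x => f 1 x + ρ 1 x :=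
  (h.measurable 1).add (h.measurable_error 1)

lemma lintegral_base_ne_top (h : GappedSubadditive μ T f ρ σ) :
    ∫⁻ x, f 1 x + ρ 1 x ∂μ ≠ ⊤ := by
  rw [lintegral_add_left (h.measurable 1)]
  exact ENNReal.add_ne_top.2 ⟨h.lintegral_ne_top 1 le_rfl, h.lintegral_error_one_ne_top⟩

lemma ae_le_add (h : GappedSubadditive μ T f ρ σ) : ∀ᵐ x ∂μ, ∀ n m, 1 ≤ n → 1 ≤ m →
    f (n + σ n + m) x ≤ f n x + ρ n x + f m (T^[n + σ n] x) := by
  simp only [ae_all_iff]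
  exact h.le_add

lemma le_base_add (h : GappedSubadditive μ T f ρ σ) {x : X}
    (hx : ∀ n m, 1 ≤ n → 1 ≤ m → f (n + σ n + m) x ≤ f n x + ρ n x + f m (T^[n + σ n] x))
    {m : ℕ} (hm : 1 ≤ m) : f (m + 1) x ≤ (f 1 x + ρ 1 x) + f m (T x) := by
  have := hx 1 m le_rfl hm
  rwa [h.gap_one, add_zero, add_comm 1 m, Function.iterate_one] at this

lemma lintegral_le (h : GappedSubadditive μ T f ρ σ) {n : ℕ} (hn : 1 ≤ n) :
    ∫⁻ x, f n x ∂μ ≤ n * ∫⁻ x, f 1 x + ρ 1 x ∂μ := by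
  rw [← lintegral_birkhoffSum h.measurePreserving h.measurable_base]
  refine lintegral_mono_ae ?_
  filter_upwards [h.ae_iterate h.ae_le_add] with x hx
  exact le_birkhoffSum_of_le_add
    (A := {x | ∀ k : ℕ, ∀ n m, 1 ≤ n → 1 ≤ m → f (n + σ n + m) (T^[k] x) ≤ f n (T^[k] x)
      + ρ n (T^[k] x) + f m (T^[n + σ n] (T^[k] x))})
    (fun y hy k => hy (k + 1)) (fun y _ => le_self_add)
    (fun y hy m hm => h.le_base_add (hy 0) hm) n hn x hx

lemma measurable_liminf (h : GappedSubadditive μ T f ρ σ) :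
    Measurable fun x => liminf (fun n : ℕ => f n x / n) atTop :=
  Measurable.liminf fun n => (h.measurable n).div_const _

/-- Fatou's lemma. -/
lemma lintegral_liminf_le (h : GappedSubadditive μ T f ρ σ) :
    ∫⁻ x, liminf (fun n : ℕ => f n x / n) atTop ∂μ
      ≤ liminf (fun n : ℕ => (∫⁻ x, f n x ∂μ) / n) atTop := by
  refine (MeasureTheory.lintegral_liminf_le fun n => (h.measurable n).div_const _).trans_eq ?_
  congr 1 with n
  simp_rw [div_eq_mul_inv]
  rw [lintegral_mul_const _ (h.measurable n)]

lemma lintegral_liminf_ne_top (h : GappedSubadditive μ T f ρ σ) :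
    ∫⁻ x, liminf (fun n : ℕ => f n x / n) atTop ∂μ ≠ ⊤ := by
  refine ne_top_of_le_ne_top h.lintegral_base_ne_top (h.lintegral_liminf_le.trans ?_)
  refine liminf_le_of_frequently_le' (Eventually.frequently ?_)
  filter_upwards [eventually_ge_atTop 1] with n hn
  refine ENNReal.div_le_of_le_mul' (h.lintegral_le hn)

/-- The lower limit of `f n / n` is invariant: it increases along orbits, and its integral does
not. -/
lemma liminf_comp_ae_eq (h : GappedSubadditive μ T f ρ σ) :
    ∀ᵐ x ∂μ, liminf (fun n : ℕ => f n (T x) / n) atTop = liminf (fun n : ℕ => f n x / n) atTop := by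
  have hle : ∀ᵐ x ∂μ, liminf (fun n : ℕ => f n x / n) atTop
      ≤ liminf (fun n : ℕ => f n (T x) / n) atTop := by
    filter_upwards [h.ae_le_add, ae_lt_top h.measurable_base h.lintegral_base_ne_top]
      with x hx hxt
    refine ENNReal.liminf_le_liminf_of_le_add (a := fun m : ℕ => (f 1 x + ρ 1 x) / m) ?_ ?_
    · simpa using ENNReal.Tendsto.const_div (a := f 1 x + ρ 1 x)
        ENNReal.tendsto_nat_nhds_top (Or.inr hxt.ne)
    · filter_upwards [eventually_ge_atTop 1] with m hm
      rw [← ENNReal.add_div]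
      gcongr
      · exact h.le_base_add hx hm
      · omega
  have := ae_eq_of_ae_le_of_lintegral_le hle h.lintegral_liminf_ne_top
    (h.measurable_liminf.comp h.measurePreserving.measurable).aemeasurable
    (h.measurePreserving.lintegral_comp h.measurable_liminf).le
  filter_upwards [this] with x hx using hx.symm

/-! ### Convergence for nonnegative sequences -/

/-- The points at which no block of length `n ∈ [1, K]` brings `(f n + ρ n) / n` within `ε` of
the lower limit of `f n / n`. -/
def badSet (f ρ : ℕ → X → ℝ≥0∞) (ε : ℝ≥0∞) (K : ℕ) : Set X :=
  {x | ∀ n, 1 ≤ n → n ≤ K → n * (liminf (fun n : ℕ => f n x / n) atTop + ε) < f n x + ρ n x}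

lemma measurableSet_badSet (h : GappedSubadditive μ T f ρ σ) (ε : ℝ≥0∞) (K : ℕ) :
    MeasurableSet (badSet f ρ ε K) := by
  have : badSet f ρ ε K = ⋂ n : ℕ, ⋂ (_ : 1 ≤ n ∧ n ≤ K),
      {x | n * (liminf (fun n : ℕ => f n x / n) atTop + ε) < f n x + ρ n x} := by
    ext x; simp [badSet]
  rw [this]
  exact .iInter fun n => .iInter fun _ =>
    measurableSet_lt ((h.measurable_liminf.add_const ε).const_mul _)
      ((h.measurable n).add (h.measurable_error n))

lemma ae_exists_notMem_badSet (h : GappedSubadditive μ T f ρ σ) {ε : ℝ≥0∞} (hε : ε ≠ 0) :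
    ∀ᵐ x ∂μ, ∃ K, x ∉ badSet f ρ ε K := by
  filter_upwards [ae_lt_top h.measurable_liminf h.lintegral_liminf_ne_top, h.tendsto_error]
    with x hL hρ
  have hε2 : (0 : ℝ≥0∞) < ε / 2 := by simpa [pos_iff_ne_zero] using hε
  have h1 : ∃ᶠ n : ℕ in atTop, f n x / n < liminf (fun n : ℕ => f n x / n) atTop + ε / 2 :=
    frequently_lt_of_liminf_lt (by isBoundedDefault) (ENNReal.lt_add_right hL.ne hε2.ne')
  have h2 : ∀ᶠ n : ℕ in atTop, ρ n x / n < ε / 2 := hρ.eventually_lt_const hε2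
  obtain ⟨n, ⟨hf, hr⟩, hn⟩ := ((h1.and_eventually h2).and_eventually
    (eventually_ge_atTop 1)).exists
  refine ⟨n, fun hx => (hx n hn le_rfl).not_ge ?_⟩
  have hn0 : (n : ℝ≥0∞) ≠ 0 := by simp; omega
  rw [mul_comm]
  refine (ENNReal.div_le_iff hn0 (by simp)).1 ?_
  rw [ENNReal.add_div]
  calc _ ≤ (liminf (fun n : ℕ => f n x / n) atTop + ε / 2) + ε / 2 := add_le_add hf.le hr.le
    _ = _ := by rw [add_assoc, ENNReal.add_halves]

lemma tendsto_setLIntegral_badSet [IsProbabilityMeasure μ] (h : GappedSubadditive μ T f ρ σ)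
    {ε : ℝ≥0∞} (hε : ε ≠ 0) :
    Tendsto (fun K => ∫⁻ x in badSet f ρ ε K, f 1 x + ρ 1 x ∂μ) atTop (𝓝 0) := by
  refine tendsto_setLIntegral_zero h.lintegral_base_ne_top ?_
  have hanti : Antitone (badSet f ρ ε) := fun K K' hK x hx n hn hnK => hx n hn (hnK.trans hK)
  have h0 : μ (⋂ K, badSet f ρ ε K) = 0 := by
    rw [measure_eq_zero_iff_ae_notMem]
    filter_upwards [h.ae_exists_notMem_badSet hε] with x hx
    simpa using hx
  rw [← h0]
  exact tendsto_measure_iInter_atTop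
    (fun K => (h.measurableSet_badSet ε K).nullMeasurableSet) hanti ⟨0, measure_ne_top _ _⟩

/-- The covering bound along almost every orbit: up to `ε`, the time spent in the bad set and a
final stretch of bounded length are the only obstructions to `f N ≤ N * liminf (f n / n)`. -/
lemma ae_le_of_badSet (h : GappedSubadditive μ T f ρ σ) (ε : ℝ≥0∞) (K : ℕ) :
    ∃ K' : ℕ, ∀ᵐ x ∂μ, ∀ N : ℕ, 1 ≤ N →
      f N x ≤ N * (liminf (fun n : ℕ => f n x / n) atTop + ε)
        + birkhoffSum T ((badSet f ρ ε K).indicator fun x => f 1 x + ρ 1 x) N x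
        + ∑ k ∈ Finset.Ico (N - K') N, (f 1 (T^[k] x) + ρ 1 (T^[k] x)) := by
  refine ⟨(Finset.range (K + 1)).sup fun n => n + σ n, ?_⟩
  filter_upwards [h.ae_iterate h.ae_le_add, h.ae_iterate h.liminf_comp_ae_eq] with x h1 h2
  intro N hN
  let A : Set X := {x | (∀ k : ℕ, ∀ n m, 1 ≤ n → 1 ≤ m → f (n + σ n + m) (T^[k] x)
      ≤ f n (T^[k] x) + ρ n (T^[k] x) + f m (T^[n + σ n] (T^[k] x))) ∧
    ∀ k : ℕ, liminf (fun n : ℕ => f n (T (T^[k] x)) / n) atTop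
      = liminf (fun n : ℕ => f n (T^[k] x) / n) atTop}
  refine le_of_blocks (A := A) (ρ := ρ) (g := fun x => f 1 x + ρ 1 x) (σ := σ)
    (ℓ := fun x => liminf (fun n : ℕ => f n x / n) atTop + ε)
    (fun y hy => ⟨fun k => hy.1 (k + 1), fun k => hy.2 (k + 1)⟩) (fun y _ => le_self_add)
    (fun y hy m hm => h.le_base_add (hy.1 0) hm)
    (fun y hy => by simpa using congrArg (· + ε) (hy.2 0)) (fun y hy => hy.1 0) ?_ N hN x ⟨h1, h2⟩
  intro y hy hyB
  simp only [badSet, Set.mem_ofPred_eq, not_forall, not_lt] at hyB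
  obtain ⟨n, hn1, hnK, hn⟩ := hyB
  exact ⟨n, hn1, Finset.le_sup (f := fun n => n + σ n) (Finset.mem_range.2 (by omega)), hn⟩

/-- The last `K` steps of an orbit segment of length `N` contribute `o(N)`. -/
lemma ae_eventually_sum_Ico_le [IsProbabilityMeasure μ] (h : GappedSubadditive μ T f ρ σ)
    {ε : ℝ≥0∞} (hε : ε ≠ 0) (K : ℕ) : ∀ᵐ x ∂μ, ∀ᶠ N : ℕ in atTop,
      ∑ k ∈ Finset.Ico (N - K) N, (f 1 (T^[k] x) + ρ 1 (T^[k] x)) ≤ ε * N := by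
  have hδ : ε / (K + 1 : ℕ) ≠ 0 := by
    simp only [ne_eq, ENNReal.div_eq_zero_iff, not_or]
    exact ⟨hε, ENNReal.natCast_ne_top _⟩
  filter_upwards [ae_eventually_comp_iterate_le h.measurePreserving h.measurable_base
    h.lintegral_base_ne_top _ hδ] with x hx
  obtain ⟨k₀, hk₀⟩ := eventually_atTop.1 hx
  filter_upwards [eventually_ge_atTop (k₀ + K)] with N hN
  calc ∑ k ∈ Finset.Ico (N - K) N, (f 1 (T^[k] x) + ρ 1 (T^[k] x))
      ≤ ∑ k ∈ Finset.Ico (N - K) N, ε / (K + 1 : ℕ) * N := by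
        refine Finset.sum_le_sum fun k hk => ?_
        rw [Finset.mem_Ico] at hk
        refine (hk₀ k (by omega)).trans ?_
        gcongr
        exact hk.2.le
    _ = ((N - (N - K) : ℕ) : ℝ≥0∞) * (ε / (K + 1 : ℕ) * N) := by simp
    _ ≤ ((K + 1 : ℕ) : ℝ≥0∞) * (ε / (K + 1 : ℕ) * N) := by
        gcongr
        omega
    _ = ε * N := by
        rw [← mul_assoc, ENNReal.mul_div_cancel (by simp) (by simp)]

/-- Outside the event in the maximal inequality for the restriction of `f 1 + ρ 1` to the bad
set, each of the three terms of the covering bound costs at most `ε`; the probability of that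
event vanishes as the bad set shrinks. -/
lemma ae_eventually_le [IsProbabilityMeasure μ] (h : GappedSubadditive μ T f ρ σ)
    {ε : ℝ≥0∞} (hε : ε ≠ 0) (hεt : ε ≠ ⊤) : ∀ᵐ x ∂μ, ∀ᶠ N : ℕ in atTop,
      f N x ≤ N * (liminf (fun n : ℕ => f n x / n) atTop + 3 * ε) := by
  set D : Set X := {x | ¬ ∀ᶠ N : ℕ in atTop,
      f N x ≤ N * (liminf (fun n : ℕ => f n x / n) atTop + 3 * ε)} with hD
  change μ D = 0
  have hle : ∀ K, μ D ≤ (∫⁻ x in badSet f ρ ε K, f 1 x + ρ 1 x ∂μ) / ε := by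
    intro K
    have hbad := h.measurableSet_badSet ε K
    rw [ENNReal.le_div_iff_mul_le (Or.inl hε) (Or.inl hεt), mul_comm,
      ← lintegral_indicator hbad]
    refine le_trans ?_ (maximal_inequality h.measurePreserving
      (h.measurable_base.indicator hbad) ε)
    refine mul_le_mul_right (measure_mono_ae ?_) ε
    obtain ⟨K', hK'⟩ := h.ae_le_of_badSet ε K
    filter_upwards [hK', h.ae_eventually_sum_Ico_le hε K'] with x hx hxt hxD
    by_contra hnot
    refine hxD ?_
    have hnot' : ∀ n : ℕ, 1 ≤ n → birkhoffSum T ((badSet f ρ ε K).indicator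
        fun x => f 1 x + ρ 1 x) n x < ε * n := by
      intro n hn
      by_contra hlt
      exact hnot ⟨n, hn, not_lt.1 hlt⟩
    filter_upwards [hxt, eventually_ge_atTop 1] with N ht hN
    calc f N x ≤ _ := hx N hN
      _ ≤ N * (liminf (fun n : ℕ => f n x / n) atTop + ε) + ε * N + ε * N := by
        gcongr
        exact (hnot' N hN).le
      _ = _ := by ring
  have hlim := ENNReal.Tendsto.div_const (h.tendsto_setLIntegral_badSet hε) (Or.inr hε)
  rw [ENNReal.zero_div] at hlim
  exact le_antisymm (ge_of_tendsto' hlim hle) zero_le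

lemma ae_tendsto [IsProbabilityMeasure μ] (h : GappedSubadditive μ T f ρ σ) :
    ∀ᵐ x ∂μ, Tendsto (fun n : ℕ => f n x / n) atTop
      (𝓝 (liminf (fun n : ℕ => f n x / n) atTop)) := by
  have hj : ∀ᵐ x ∂μ, ∀ j : ℕ, ∀ᶠ N : ℕ in atTop,
      f N x ≤ N * (liminf (fun n : ℕ => f n x / n) atTop + 3 * ((j + 1 : ℕ) : ℝ≥0∞)⁻¹) :=
    ae_all_iff.2 fun j => h.ae_eventually_le (by simp) (by simp)
  filter_upwards [hj] with x hx
  refine tendsto_of_le_liminf_of_limsup_le le_rfl ?_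
  have hlim : Tendsto (fun j : ℕ => liminf (fun n : ℕ => f n x / n) atTop
      + 3 * ((j + 1 : ℕ) : ℝ≥0∞)⁻¹) atTop (𝓝 (liminf (fun n : ℕ => f n x / n) atTop + 3 * 0)) :=
    tendsto_const_nhds.add (ENNReal.Tendsto.const_mul
      (ENNReal.tendsto_inv_nat_nhds_zero.comp (tendsto_add_atTop_nat 1)) (Or.inr (by simp)))
  rw [mul_zero, add_zero] at hlim
  refine ge_of_tendsto' hlim fun j => ?_
  refine limsup_le_of_le (by isBoundedDefault) ?_
  filter_upwards [hx j] with N hN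
  exact ENNReal.div_le_of_le_mul' hN

/-- The lower bound is Fatou's lemma, the upper bound is the integrated covering bound. -/
lemma tendsto_lintegral [IsProbabilityMeasure μ] (h : GappedSubadditive μ T f ρ σ) :
    Tendsto (fun n : ℕ => (∫⁻ x, f n x ∂μ) / n) atTop
      (𝓝 (∫⁻ x, liminf (fun n : ℕ => f n x / n) atTop ∂μ)) := by
  refine tendsto_of_le_liminf_of_limsup_le h.lintegral_liminf_le ?_
  set I := ∫⁻ x, liminf (fun n : ℕ => f n x / n) atTop ∂μ with hI
  have hbound : ∀ (ε : ℝ≥0∞) (K : ℕ), limsup (fun n : ℕ => (∫⁻ x, f n x ∂μ) / n) atTop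
      ≤ I + ε + ∫⁻ x in badSet f ρ ε K, f 1 x + ρ 1 x ∂μ := by
    intro ε K
    have hbad := h.measurableSet_badSet ε K
    obtain ⟨K', hK'⟩ := h.ae_le_of_badSet ε K
    have hlim : Tendsto (fun N : ℕ => I + ε + (∫⁻ x in badSet f ρ ε K, f 1 x + ρ 1 x ∂μ)
        + K' * (∫⁻ x, f 1 x + ρ 1 x ∂μ) / N) atTop
        (𝓝 (I + ε + (∫⁻ x in badSet f ρ ε K, f 1 x + ρ 1 x ∂μ) + 0)) := by
      refine tendsto_const_nhds.add ?_
      have hfin : (K' : ℝ≥0∞) * (∫⁻ x, f 1 x + ρ 1 x ∂μ) ≠ ⊤ :=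
        ENNReal.mul_ne_top (by simp) h.lintegral_base_ne_top
      simpa using ENNReal.Tendsto.const_div ENNReal.tendsto_nat_nhds_top (Or.inr hfin)
    rw [add_zero] at hlim
    rw [← hlim.limsup_eq]
    refine limsup_le_limsup ?_
    filter_upwards [eventually_ge_atTop 1] with N hN
    have hN0 : (N : ℝ≥0∞) ≠ 0 := by simp; omega
    refine ENNReal.div_le_of_le_mul' ?_
    have hm1 : Measurable fun x => (N : ℝ≥0∞) * (liminf (fun n : ℕ => f n x / n) atTop + ε) :=
      (h.measurable_liminf.add_const ε).const_mul _
    have hm2 := measurable_birkhoffSum h.measurePreserving.measurable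
      (h.measurable_base.indicator hbad) N
    have hm3 : ∀ k : ℕ, Measurable fun x => f 1 (T^[k] x) + ρ 1 (T^[k] x) := fun k =>
      h.measurable_base.comp (h.measurePreserving.iterate k).measurable
    have htail : ∫⁻ x, ∑ k ∈ Finset.Ico (N - K') N, (f 1 (T^[k] x) + ρ 1 (T^[k] x)) ∂μ
        ≤ K' * ∫⁻ x, f 1 x + ρ 1 x ∂μ := by
      rw [lintegral_finsetSum _ fun k _ => hm3 k, Finset.sum_congr rfl fun k _ =>
        (h.measurePreserving.iterate k).lintegral_comp h.measurable_base]
      rw [Finset.sum_const, Nat.card_Ico, nsmul_eq_mul]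
      gcongr
      omega
    calc ∫⁻ x, f N x ∂μ ≤ _ := lintegral_mono_ae (hK'.mono fun x hx => hx N hN)
      _ = N * (I + ε) + N * (∫⁻ x in badSet f ρ ε K, f 1 x + ρ 1 x ∂μ)
          + ∫⁻ x, ∑ k ∈ Finset.Ico (N - K') N, (f 1 (T^[k] x) + ρ 1 (T^[k] x)) ∂μ := by
        rw [lintegral_add_left (f := fun x => (N : ℝ≥0∞) * (liminf (fun n : ℕ => f n x / n) atTop + ε)
              + birkhoffSum T ((badSet f ρ ε K).indicator fun x => f 1 x + ρ 1 x) N x)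
              (hm1.add hm2), lintegral_add_left hm1,
          lintegral_const_mul _ (h.measurable_liminf.add_const ε),
          lintegral_add_left h.measurable_liminf,
          lintegral_birkhoffSum h.measurePreserving (h.measurable_base.indicator hbad),
          lintegral_indicator hbad]
        simp [hI]
      _ ≤ N * (I + ε) + N * (∫⁻ x in badSet f ρ ε K, f 1 x + ρ 1 x ∂μ)
          + K' * ∫⁻ x, f 1 x + ρ 1 x ∂μ := by gcongr
      _ = _ := by
        rw [mul_add (N : ℝ≥0∞) (_ + _), ENNReal.mul_div_cancel hN0 (by simp)]
        ring
  have hε : ∀ ε : ℝ≥0∞, ε ≠ 0 → limsup (fun n : ℕ => (∫⁻ x, f n x ∂μ) / n) atTop ≤ I + ε := by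
    intro ε hε
    have := (tendsto_const_nhds (x := I + ε)).add (h.tendsto_setLIntegral_badSet hε)
    rw [add_zero] at this
    exact ge_of_tendsto' this (hbound ε)
  have hlim : Tendsto (fun j : ℕ => I + ((j + 1 : ℕ) : ℝ≥0∞)⁻¹) atTop (𝓝 (I + 0)) :=
    tendsto_const_nhds.add (ENNReal.tendsto_inv_nat_nhds_zero.comp (tendsto_add_atTop_nat 1))
  rw [add_zero] at hlim
  exact ge_of_tendsto' hlim fun j => hε _ (by simp)

/-- A Fekete-type lower bound for the integral of `f n`, from cutting `[0, j * (n + σ n))` into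
`j` equal blocks and letting `j → ∞`. -/
lemma mul_lintegral_liminf_le [IsProbabilityMeasure μ] (h : GappedSubadditive μ T f ρ σ)
    {n : ℕ} (hn : 1 ≤ n) :
    ((n + σ n : ℕ) : ℝ≥0∞) * ∫⁻ x, liminf (fun n : ℕ => f n x / n) atTop ∂μ
      ≤ ∫⁻ x, f n x ∂μ + ∫⁻ x, ρ n x ∂μ := by
  set p := n + σ n with hp
  have hstep : ∀ j : ℕ, ∫⁻ x, f (j * p + 1) x ∂μ
      ≤ j * (∫⁻ x, f n x ∂μ + ∫⁻ x, ρ n x ∂μ) + ∫⁻ x, f 1 x ∂μ := by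
    intro j
    induction j with
    | zero => simp
    | succ j ih =>
      calc ∫⁻ x, f ((j + 1) * p + 1) x ∂μ
          ≤ ∫⁻ x, f n x + ρ n x + f (j * p + 1) (T^[p] x) ∂μ := by
            refine lintegral_mono_ae ?_
            filter_upwards [h.le_add n (j * p + 1) hn (by omega)] with x hx
            rwa [← hp, show p + (j * p + 1) = (j + 1) * p + 1 by ring] at hx
        _ = ∫⁻ x, f n x ∂μ + ∫⁻ x, ρ n x ∂μ + ∫⁻ x, f (j * p + 1) x ∂μ := by
            rw [lintegral_add_left (f := fun x => f n x + ρ n x) ((h.measurable n).add (h.measurable_error n)),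
              lintegral_add_left (h.measurable n),
              (h.measurePreserving.iterate p).lintegral_comp (h.measurable _)]
        _ ≤ _ := add_le_add le_rfl ih
        _ = _ := by push_cast; ring
  set I := ∫⁻ x, liminf (fun n : ℕ => f n x / n) atTop ∂μ
  set S := ∫⁻ x, f n x ∂μ + ∫⁻ x, ρ n x ∂μ
  have hsub : Tendsto (fun j : ℕ => j * p + 1) atTop atTop :=
    tendsto_atTop_mono (fun j => (Nat.le_mul_of_pos_right j (by omega)).trans (Nat.le_succ _)) tendsto_id
  have h1 : Tendsto (fun j : ℕ => (p : ℝ≥0∞) * ((∫⁻ x, f (j * p + 1) x ∂μ)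
      / ((j * p + 1 : ℕ) : ℝ≥0∞))) atTop (𝓝 (p * I)) :=
    ENNReal.Tendsto.const_mul (h.tendsto_lintegral.comp hsub) (Or.inr (by simp))
  have h2 : Tendsto (fun j : ℕ => S + (∫⁻ x, f 1 x ∂μ) / j) atTop (𝓝 (S + 0)) := by
    refine tendsto_const_nhds.add ?_
    simpa using ENNReal.Tendsto.const_div ENNReal.tendsto_nat_nhds_top
      (Or.inr (h.lintegral_ne_top 1 le_rfl))
  rw [add_zero] at h2
  refine le_of_tendsto_of_tendsto h1 h2 ?_
  filter_upwards [eventually_ge_atTop 1] with j hj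
  have hj0 : (j : ℝ≥0∞) ≠ 0 := by simp; omega
  have hp0 : (p : ℝ≥0∞) ≠ 0 := by simp; omega
  calc (p : ℝ≥0∞) * ((∫⁻ x, f (j * p + 1) x ∂μ) / ((j * p + 1 : ℕ) : ℝ≥0∞))
      ≤ p * ((j * S + ∫⁻ x, f 1 x ∂μ) / (p * j)) := by
        gcongr
        · exact hstep j
        · push_cast
          rw [mul_comm]
          exact le_self_add
    _ = (j * S + ∫⁻ x, f 1 x ∂μ) / j := by
        rw [← mul_div_assoc, ENNReal.mul_div_mul_left _ _ hp0 (by simp)]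
    _ = S + (∫⁻ x, f 1 x ∂μ) / j := by
        rw [ENNReal.add_div, mul_div_assoc, ENNReal.mul_div_cancel hj0 (by simp)]

end GappedSubadditive

/-! ### Truncation in `[-∞, ∞]` -/

namespace EReal

/-- The identity `(y + c)₊ + min y₋ c = y₊ + c`, with no subtraction in `[0, ∞]`. -/
lemma toENNReal_add_natCast_add_min (y : EReal) (c : ℕ) :
    (y + c).toENNReal + min (-y).toENNReal c = y.toENNReal + c := by
  induction y with
  | bot => simp
  | top => simp [EReal.top_add_of_ne_bot (EReal.natCast_ne_bot c)]
  | coe r =>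
    have h1 : ((r : EReal) + (c : EReal)) = ((r + c : ℝ) : EReal) := by push_cast; rfl
    have h2 : (-(r : EReal)) = ((-r : ℝ) : EReal) := by push_cast; rfl
    have hc : (0 : ℝ) ≤ c := by positivity
    rw [h1, h2, real_coe_toENNReal, real_coe_toENNReal, real_coe_toENNReal,
      ← ENNReal.ofReal_natCast c, ← ENNReal.ofReal_min]
    rcases le_total 0 r with hr | hr
    · rw [min_eq_left (by linarith), ENNReal.ofReal_of_nonpos (p := -r) (by linarith), add_zero,
        ENNReal.ofReal_add hr hc]
    · rw [ENNReal.ofReal_of_nonpos hr, zero_add]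
      rcases le_total (-r) c with hrc | hrc
      · rw [min_eq_left hrc, ← ENNReal.ofReal_add (by linarith) (by linarith)]
        congr 1; ring
      · rw [min_eq_right hrc, ENNReal.ofReal_of_nonpos (by linarith), zero_add]

lemma toENNReal_div_add_natCast (y : EReal) (M : ℕ) {n : ℕ} (hn : 1 ≤ n) :
    (y / n + M).toENNReal = (y + (M * n : ℕ)).toENNReal / n := by
  have hn0 : (0 : ℝ) < n := by exact_mod_cast hn
  have hn0' : (0 : EReal) < n := by exact_mod_cast hn
  induction y with
  | bot => simp [EReal.bot_div_of_pos_ne_top hn0' (EReal.natCast_ne_top n)]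
  | top =>
    rw [EReal.top_div_of_pos_ne_top hn0' (EReal.natCast_ne_top n),
      EReal.top_add_of_ne_bot (EReal.natCast_ne_bot _),
      EReal.top_add_of_ne_bot (EReal.natCast_ne_bot _), toENNReal_top,
      ENNReal.top_div_of_ne_top (by simp)]
  | coe r =>
    have h1 : ((r : EReal) / (n : EReal) + (M : EReal)) = ((r / n + M : ℝ) : EReal) := by
      push_cast; rfl
    have h2 : ((r : EReal) + ((M * n : ℕ) : EReal)) = ((r + M * n : ℝ) : EReal) := by
      push_cast; rfl
    rw [h1, h2, real_coe_toENNReal, real_coe_toENNReal, ← ENNReal.ofReal_natCast n,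
      ← ENNReal.ofReal_div_of_pos hn0]
    congr 1
    field_simp

/-- Adding `M` per unit of length turns gaps into errors: a gap of length `s` costs `M * s`. -/
lemma toENNReal_add_natCast_le_of_le_add {a b d : EReal} {r : ℝ} (h : a ≤ b + r + d)
    (M n s m : ℕ) :
    (a + (M * (n + s + m) : ℕ)).toENNReal ≤ (b + (M * n : ℕ)).toENNReal
      + (ENNReal.ofReal r + (M * s : ℕ)) + (d + (M * m : ℕ)).toENNReal := by
  have hnat : ∀ k : ℕ, ((k : EReal)).toENNReal = k := fun k => by
    rw [show (k : EReal) = ((k : ℝ) : EReal) from rfl, real_coe_toENNReal, ENNReal.ofReal_natCast]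
  calc (a + (M * (n + s + m) : ℕ)).toENNReal
      ≤ ((b + r + d) + (M * (n + s + m) : ℕ)).toENNReal :=
        toENNReal_le_toENNReal (add_le_add h le_rfl)
    _ = ((b + (M * n : ℕ)) + (r + (M * s : ℕ)) + (d + (M * m : ℕ))).toENNReal := by
        congr 1
        rw [show M * (n + s + m) = M * n + M * s + M * m by ring, Nat.cast_add, Nat.cast_add]
        abel
    _ ≤ _ := by
        refine toENNReal_add_le.trans (add_le_add (toENNReal_add_le.trans
          (add_le_add le_rfl (toENNReal_add_le.trans ?_))) le_rfl)
        rw [real_coe_toENNReal, hnat]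

lemma continuous_toENNReal_add_natCast (M : ℕ) :
    Continuous fun y : EReal => (y + M).toENNReal := by
  refine continuous_toENNReal.comp (continuous_iff_continuousAt.2 fun y => ?_)
  exact (EReal.continuousAt_add (p := (y, (M : EReal))) (Or.inr (EReal.natCast_ne_bot M))
    (Or.inr (EReal.natCast_ne_top M))).comp (f := fun y : EReal => (y, (M : EReal)))
    (Continuous.prodMk_left _).continuousAt

/-- Convergence in `[-∞, ∞]` can be tested on the truncations from below at the levels `-M`. -/
lemma tendsto_limsup_of_tendsto_truncation {u : ℕ → EReal}
    (h : ∀ M : ℕ, ∃ l : ℝ≥0∞, Tendsto (fun n => (u n + M).toENNReal) atTop (𝓝 l)) :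
    Tendsto u atTop (𝓝 (limsup u atTop)) := by
  refine tendsto_of_le_liminf_of_limsup_le ?_ le_rfl
  by_contra! hlt
  -- With `-M` below a real `r` strictly between the two limits, the truncation separates them.
  obtain ⟨r, hr1, hr2⟩ := EReal.lt_iff_exists_real_btwn.1 hlt
  obtain ⟨M, hM⟩ := exists_nat_ge (-r)
  obtain ⟨l, hl⟩ := h M
  have hmono : Monotone fun y : EReal => (y + M).toENNReal := fun y z hyz =>
    toENNReal_le_toENNReal (add_le_add hyz le_rfl)
  have h1 := hmono.map_limsup_of_continuousAt (F := atTop) u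
    (continuous_toENNReal_add_natCast M).continuousAt
  have h2 := hmono.map_liminf_of_continuousAt (F := atTop) u
    (continuous_toENNReal_add_natCast M).continuousAt
  have h3 : ((limsup u atTop) + M).toENNReal = ((liminf u atTop) + M).toENNReal := by
    rw [h1, h2]
    exact (Tendsto.limsup_eq hl).trans (Tendsto.liminf_eq hl).symm
  have hpos : (0 : EReal) ≤ (r : EReal) + M := by
    have : (0 : ℝ) ≤ r + M := by linarith
    exact_mod_cast this
  have h4 : ((r : EReal) + M).toENNReal < ((limsup u atTop) + M).toENNReal :=
    toENNReal_lt_toENNReal hpos (EReal.add_lt_add_of_lt_of_le hr2 le_rfl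
      (EReal.natCast_ne_bot M) (EReal.natCast_ne_top M))
  exact (h4.trans_le (h3.le.trans (hmono hr1.le))).false

end EReal

/-- The integral `∫ max g (-c) dμ` of a function truncated from below, as a real number. It is
meaningful when `∫ g₊ dμ` is finite. -/
noncomputable def truncatedIntegral {X : Type*} [MeasurableSpace X] (μ : Measure X)
    (g : X → EReal) (c : ℕ) : ℝ :=
  (posPartIntegral μ g).toReal - (∫⁻ x, min (-g x).toENNReal c ∂μ).toReal

section truncatedIntegral

variable {X : Type*} [MeasurableSpace X] {μ : Measure X} {g : X → EReal}

lemma lintegral_min_natCast_ne_top [IsProbabilityMeasure μ] (h : X → ℝ≥0∞) (c : ℕ) :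
    ∫⁻ x, min (h x) c ∂μ ≠ ⊤ := by
  refine ne_top_of_le_ne_top (b := (c : ℝ≥0∞)) (by simp)
    ((lintegral_mono fun x => min_le_right _ _).trans ?_)
  simp

lemma lintegral_toENNReal_add_natCast [IsProbabilityMeasure μ] (hg : Measurable g) (c : ℕ) :
    ∫⁻ x, (g x + c).toENNReal ∂μ + ∫⁻ x, min (-g x).toENNReal c ∂μ
      = posPartIntegral μ g + c := by
  rw [posPartIntegral, ← lintegral_add_right _ (g := fun x => min (-g x).toENNReal (c : ℝ≥0∞))
    (hg.neg.ereal_toENNReal.min measurable_const)]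
  simp_rw [EReal.toENNReal_add_natCast_add_min]
  rw [lintegral_add_right _ measurable_const]
  simp

lemma lintegral_toENNReal_add_natCast_ne_top [IsProbabilityMeasure μ] (hg : Measurable g)
    (hp : posPartIntegral μ g ≠ ⊤) (c : ℕ) : ∫⁻ x, (g x + c).toENNReal ∂μ ≠ ⊤ :=
  ne_top_of_le_ne_top (ENNReal.add_ne_top.2 ⟨hp, ENNReal.natCast_ne_top c⟩)
    (le_self_add.trans (lintegral_toENNReal_add_natCast hg c).le)

lemma toReal_lintegral_toENNReal_add_natCast [IsProbabilityMeasure μ] (hg : Measurable g)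
    (hp : posPartIntegral μ g ≠ ⊤) (c : ℕ) :
    (∫⁻ x, (g x + c).toENNReal ∂μ).toReal = truncatedIntegral μ g c + c := by
  have h := congrArg ENNReal.toReal (lintegral_toENNReal_add_natCast (μ := μ) hg c)
  rw [ENNReal.toReal_add (lintegral_toENNReal_add_natCast_ne_top hg hp c)
    (lintegral_min_natCast_ne_top _ c), ENNReal.toReal_add hp (by simp),
    ENNReal.toReal_natCast] at h
  rw [truncatedIntegral]
  linarith

lemma coe_truncatedIntegral [IsProbabilityMeasure μ] (hp : posPartIntegral μ g ≠ ⊤) (c : ℕ) :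
    (truncatedIntegral μ g c : EReal)
      = (posPartIntegral μ g : EReal) - ((∫⁻ x, min (-g x).toENNReal c ∂μ : ℝ≥0∞) : EReal) := by
  rw [truncatedIntegral, EReal.coe_sub, EReal.coe_ennreal_toReal hp,
    EReal.coe_ennreal_toReal (lintegral_min_natCast_ne_top _ c)]

lemma extIntegral_le_truncatedIntegral [IsProbabilityMeasure μ]
    (hp : posPartIntegral μ g ≠ ⊤) (c : ℕ) : extIntegral μ g ≤ truncatedIntegral μ g c := by
  rw [coe_truncatedIntegral hp, extIntegral]
  refine EReal.sub_le_sub le_rfl (EReal.coe_ennreal_le_coe_ennreal_iff.2 ?_)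
  exact lintegral_mono fun x => min_le_left _ _

lemma tendsto_truncatedIntegral [IsProbabilityMeasure μ] (hg : Measurable g)
    (hp : posPartIntegral μ g ≠ ⊤) :
    Tendsto (fun c => (truncatedIntegral μ g c : EReal)) atTop (𝓝 (extIntegral μ g)) := by
  have hlim : Tendsto (fun c : ℕ => ∫⁻ x, min (-g x).toENNReal c ∂μ) atTop
      (𝓝 (posPartIntegral μ fun x => -g x)) := by
    refine lintegral_tendsto_of_tendsto_of_monotone
      (fun c => (hg.neg.ereal_toENNReal.min measurable_const).aemeasurable)
      (.of_forall fun x c c' hc => min_le_min le_rfl (by exact_mod_cast hc))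
      (.of_forall fun x => ?_)
    simpa using (tendsto_const_nhds (x := (-g x).toENNReal)).min ENNReal.tendsto_nat_nhds_top
  simp_rw [coe_truncatedIntegral hp, extIntegral, sub_eq_add_neg]
  have h1 : (posPartIntegral μ g : EReal) ≠ ⊤ := by simpa using hp
  have h2 : (posPartIntegral μ g : EReal) ≠ ⊥ := EReal.coe_ennreal_ne_bot _
  exact (EReal.continuousAt_add (p := ((posPartIntegral μ g : EReal), _)) (Or.inl h1)
    (Or.inl h2)).tendsto.comp (tendsto_const_nhds.prodMk_nhds
      ((continuous_coe_ennreal_ereal.tendsto _).comp hlim).neg)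

end truncatedIntegral

/-- Passage to the limit in the truncation level: upper bounds on `I n / n` come from the
truncated integrals `e M n`, lower bounds from the Fekete-type inequality. -/
lemma tendsto_div_of_truncation {e : ℕ → ℕ → ℝ} {E : ℕ → ℝ} {I : ℕ → EReal} {J : EReal}
    {r : ℕ → ℝ} {σ : ℕ → ℕ} (hσ : (fun n => (σ n : ℝ)) =o[atTop] (fun n => (n : ℝ)))
    (hr : Tendsto (fun n : ℕ => r n / n) atTop (𝓝 0))
    (he : ∀ M, Tendsto (fun n : ℕ => e M n / n) atTop (𝓝 (E M)))
    (hle : ∀ M n : ℕ, 1 ≤ n → ((n : ℝ) + σ n) * E M ≤ e M n + r n)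
    (hI : ∀ M n : ℕ, 1 ≤ n → I n ≤ e M n)
    (hIlim : ∀ n, 1 ≤ n → Tendsto (fun M => (e M n : EReal)) atTop (𝓝 (I n)))
    (hJ : ∀ M, J ≤ E M) (hJlim : Tendsto (fun M => (E M : EReal)) atTop (𝓝 J)) :
    Tendsto (fun n : ℕ => I n / (n : EReal)) atTop (𝓝 J) := by
  refine tendsto_order.2 ⟨fun b hb => ?_, fun b hb => ?_⟩
  · lift J to ℝ using ⟨ne_top_of_le_ne_top (EReal.coe_ne_top _) (hJ 0), ne_bot_of_gt hb⟩
    have hlow : ∀ n : ℕ, 1 ≤ n → (((n + σ n) * J - r n : ℝ) : EReal) ≤ I n := by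
      intro n hn
      refine ge_of_tendsto' (hIlim n hn) fun M => EReal.coe_le_coe_iff.2 ?_
      have h1 : J ≤ E M := EReal.coe_le_coe_iff.1 (hJ M)
      have h2 : ((n : ℝ) + σ n) * J ≤ (n + σ n) * E M :=
        mul_le_mul_of_nonneg_left h1 (by positivity)
      linarith [hle M n hn]
    have hlim : Tendsto (fun n : ℕ => (1 + (σ n : ℝ) / n) * J - r n / n) atTop (𝓝 J) := by
      have h1 : Tendsto (fun n : ℕ => (σ n : ℝ) / n) atTop (𝓝 0) := hσ.tendsto_div_nhds_zero
      simpa using ((h1.const_add 1).mul_const J).sub hr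
    have hev := ((continuous_coe_real_ereal.tendsto J).comp hlim).eventually_const_lt hb
    filter_upwards [hev, eventually_ge_atTop 1] with n hbn hn
    refine hbn.trans_le ?_
    have hn0 : (n : ℝ) ≠ 0 := by positivity
    have heq : (1 + (σ n : ℝ) / n) * J - r n / n = ((n + σ n) * J - r n) / n := by
      field_simp
    rw [Function.comp_apply, heq, EReal.coe_div]
    exact EReal.div_le_div_right_of_nonneg (by positivity) (hlow n hn)
  · obtain ⟨M, hM⟩ := (hJlim.eventually_lt_const hb).exists
    have hev := ((continuous_coe_real_ereal.tendsto _).comp (he M)).eventually_lt_const hM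
    filter_upwards [hev, eventually_ge_atTop 1] with n hbn hn
    refine lt_of_le_of_lt ?_ hbn
    rw [Function.comp_apply, EReal.coe_div]
    exact EReal.div_le_div_right_of_nonneg (by positivity) (hI M n hn)

/-! ### The theorem in `[-∞, ∞)` -/

/-- Truncating `f n` from below at `-M * n` and adding `M * n` gives a nonnegative gapped
subadditive sequence, with errors `ρ n + M * σ n`. -/
lemma gappedSubadditive_truncation {X : Type*} [MeasurableSpace X] {μ : Measure X}
    [IsProbabilityMeasure μ] {T : X → X} (hT : MeasurePreserving T μ μ)
    {f : ℕ → X → EReal} (hf_meas : ∀ n, Measurable (f n))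
    (hf_pos : ∀ n, 1 ≤ n → posPartIntegral μ (f n) ≠ ⊤)
    {σ : ℕ → ℕ} (hσ : (fun n => (σ n : ℝ)) =o[atTop] (fun n => (n : ℝ))) (hσ_one : σ 1 = 0)
    {ρ : ℕ → X → ℝ} (hρ_meas : ∀ n, Measurable (ρ n))
    (hρ_int : ∀ n, 1 ≤ n → Integrable (ρ n) μ)
    (hsub : ∀ n m, 1 ≤ n → 1 ≤ m →
      ∀ᵐ x ∂μ, f (n + σ n + m) x ≤ f n x + (ρ n x : EReal) + f m (T^[n + σ n] x))
    (hρ_lim : ∀ᵐ x ∂μ, Tendsto (fun n : ℕ => ρ n x / (n : ℝ)) atTop (𝓝 0)) (M : ℕ) :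
    GappedSubadditive μ T (fun n x => (f n x + (M * n : ℕ)).toENNReal)
      (fun n x => ENNReal.ofReal (ρ n x) + (M * σ n : ℕ)) σ where
  measurePreserving := hT
  measurable n := (EReal.continuous_toENNReal_add_natCast _).measurable.comp (hf_meas n)
  measurable_error n := (hρ_meas n).ennreal_ofReal.add_const _
  lintegral_ne_top n hn :=
    lintegral_toENNReal_add_natCast_ne_top (hf_meas n) (hf_pos n hn) (M * n)
  lintegral_error_one_ne_top := by
    simpa [hσ_one] using (hρ_int 1 le_rfl).lintegral_lt_top.ne
  gap_one := hσ_one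
  le_add n m hn hm := by
    filter_upwards [hsub n m hn hm] with x hx
    exact EReal.toENNReal_add_natCast_le_of_le_add hx M n (σ n) m
  tendsto_error := by
    filter_upwards [hρ_lim] with x hx
    have h1 : Tendsto (fun n : ℕ => (σ n : ℝ) / n) atTop (𝓝 0) := hσ.tendsto_div_nhds_zero
    have h2 := (ENNReal.tendsto_ofReal hx).add (ENNReal.tendsto_ofReal (h1.const_mul (M : ℝ)))
    rw [mul_zero, ENNReal.ofReal_zero, add_zero] at h2
    refine h2.congr' ?_
    filter_upwards [eventually_ge_atTop 1] with n hn
    have hn0 : (0 : ℝ) < n := by exact_mod_cast hn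
    rw [ENNReal.ofReal_div_of_pos hn0, ← mul_div_assoc, ENNReal.ofReal_div_of_pos hn0,
      ENNReal.ofReal_natCast, ← ENNReal.add_div, ← Nat.cast_mul, ENNReal.ofReal_natCast]

/-- The gapped subadditive ergodic theorem for everywhere measurable data; the limit is the
upper limit of `f n / n`. -/
theorem gapped_subadditive_of_measurable {X : Type*} [MeasurableSpace X] {μ : Measure X}
    [IsProbabilityMeasure μ] {T : X → X} (hT : MeasurePreserving T μ μ)
    {f : ℕ → X → EReal} (hf_meas : ∀ n, Measurable (f n))
    (hf_pos : ∀ n, 1 ≤ n → posPartIntegral μ (f n) ≠ ⊤)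
    {σ : ℕ → ℕ} (hσ : (fun n => (σ n : ℝ)) =o[atTop] (fun n => (n : ℝ))) (hσ_one : σ 1 = 0)
    {ρ : ℕ → X → ℝ} (hρ_meas : ∀ n, Measurable (ρ n))
    (hρ_nonneg : ∀ n, 1 ≤ n → ∀ᵐ x ∂μ, 0 ≤ ρ n x)
    (hρ_int : ∀ n, 1 ≤ n → Integrable (ρ n) μ)
    (hsub : ∀ n m, 1 ≤ n → 1 ≤ m →
      ∀ᵐ x ∂μ, f (n + σ n + m) x ≤ f n x + (ρ n x : EReal) + f m (T^[n + σ n] x))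
    (hρ_lim : ∀ᵐ x ∂μ, Tendsto (fun n : ℕ => ρ n x / (n : ℝ)) atTop (𝓝 0))
    (hρ_mean : Tendsto (fun n : ℕ => (∫ x, ρ n x ∂μ) / (n : ℝ)) atTop (𝓝 0)) :
    ∃ F : X → EReal, Measurable F ∧
      (∀ᵐ x ∂μ, Tendsto (fun n : ℕ => f n x / (n : EReal)) atTop (𝓝 (F x))) ∧
      posPartIntegral μ F ≠ ⊤ ∧
      Tendsto (fun n : ℕ => extIntegral μ (f n) / (n : EReal)) atTop (𝓝 (extIntegral μ F)) := by
  have hG : ∀ M, GappedSubadditive μ T (fun n x => (f n x + (M * n : ℕ)).toENNReal)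
      (fun n x => ENNReal.ofReal (ρ n x) + (M * σ n : ℕ)) σ :=
    gappedSubadditive_truncation hT hf_meas hf_pos hσ hσ_one hρ_meas hρ_int hsub hρ_lim
  set L : ℕ → X → ℝ≥0∞ := fun M x =>
    liminf (fun n : ℕ => (f n x + (M * n : ℕ)).toENNReal / n) atTop
  -- `F` is an upper limit only to have a measurable function defined everywhere.
  set F : X → EReal := fun x => limsup (fun n : ℕ => f n x / (n : EReal)) atTop
  have hF_meas : Measurable F := Measurable.limsup fun n => by
    simp_rw [div_eq_mul_inv]
    exact (hf_meas n).mul_const _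
  have htrunc : ∀ᵐ x ∂μ, ∀ M : ℕ,
      Tendsto (fun n : ℕ => (f n x / (n : EReal) + M).toENNReal) atTop (𝓝 (L M x)) := by
    refine ae_all_iff.2 fun M => ?_
    filter_upwards [(hG M).ae_tendsto] with x hx
    refine hx.congr' ?_
    filter_upwards [eventually_ge_atTop 1] with n hn
    exact (EReal.toENNReal_div_add_natCast (f n x) M hn).symm
  have hlim : ∀ᵐ x ∂μ, Tendsto (fun n : ℕ => f n x / (n : EReal)) atTop (𝓝 (F x)) :=
    htrunc.mono fun x hx => EReal.tendsto_limsup_of_tendsto_truncation fun M => ⟨_, hx M⟩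
  have hLF : ∀ M : ℕ, ∫⁻ x, L M x ∂μ = ∫⁻ x, (F x + M).toENNReal ∂μ := by
    intro M
    refine lintegral_congr_ae ?_
    filter_upwards [htrunc, hlim] with x hx hx'
    exact tendsto_nhds_unique (hx M)
      (((EReal.continuous_toENNReal_add_natCast M).tendsto _).comp hx')
  have hF_pos : posPartIntegral μ F ≠ ⊤ := by
    have := (hG 0).lintegral_liminf_ne_top
    change ∫⁻ x, L 0 x ∂μ ≠ ⊤ at this
    rw [hLF] at this
    simpa [posPartIntegral] using this
  refine ⟨F, hF_meas, hlim, hF_pos, ?_⟩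
  refine tendsto_div_of_truncation (e := fun M n => truncatedIntegral μ (f n) (M * n))
    (E := fun M => truncatedIntegral μ F M) hσ hρ_mean ?_ ?_
    (fun M n hn => extIntegral_le_truncatedIntegral (hf_pos n hn) _) ?_
    (fun M => extIntegral_le_truncatedIntegral hF_pos M) (tendsto_truncatedIntegral hF_meas hF_pos)
  · -- Convergence at a fixed truncation level, with the shift by `M` removed again.
    intro M
    have h := (hG M).tendsto_lintegral
    change Tendsto _ _ (𝓝 (∫⁻ x, L M x ∂μ)) at h
    rw [hLF] at h
    have h1 := (ENNReal.tendsto_toReal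
      (lintegral_toENNReal_add_natCast_ne_top hF_meas hF_pos M)).comp h
    rw [toReal_lintegral_toENNReal_add_natCast hF_meas hF_pos M] at h1
    have h2 := h1.sub_const (M : ℝ)
    rw [add_sub_cancel_right] at h2
    refine h2.congr' ?_
    filter_upwards [eventually_ge_atTop 1] with n hn
    have hn0 : (n : ℝ) ≠ 0 := by positivity
    rw [Function.comp_apply, ENNReal.toReal_div,
      toReal_lintegral_toENNReal_add_natCast (hf_meas n) (hf_pos n hn), ENNReal.toReal_natCast]
    push_cast
    field_simp
    ring
  · -- On both sides the shift contributes `M * (n + σ n)`, which cancels.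
    intro M n hn
    have h := (hG M).mul_lintegral_liminf_le hn
    change _ * ∫⁻ x, L M x ∂μ ≤ _ at h
    rw [hLF, lintegral_add_right _ measurable_const, lintegral_const, measure_univ, mul_one,
      ← ofReal_integral_eq_lintegral_ofReal (hρ_int n hn) (hρ_nonneg n hn)] at h
    have hfin := lintegral_toENNReal_add_natCast_ne_top (μ := μ) (hf_meas n) (hf_pos n hn) (M * n)
    have hgap : ((M * σ n : ℕ) : ℝ≥0∞) ≠ ⊤ := ENNReal.natCast_ne_top _
    have herr : ENNReal.ofReal (∫ x, ρ n x ∂μ) + (M * σ n : ℕ) ≠ ⊤ :=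
      ENNReal.add_ne_top.2 ⟨ENNReal.ofReal_ne_top, hgap⟩
    have h1 := ENNReal.toReal_mono (ENNReal.add_ne_top.2 ⟨hfin, herr⟩) h
    rw [ENNReal.toReal_mul, ENNReal.toReal_add hfin herr,
      ENNReal.toReal_add ENNReal.ofReal_ne_top hgap,
      ENNReal.toReal_ofReal (integral_nonneg_of_ae (hρ_nonneg n hn)),
      toReal_lintegral_toENNReal_add_natCast (hf_meas n) (hf_pos n hn),
      toReal_lintegral_toENNReal_add_natCast hF_meas hF_pos, ENNReal.toReal_natCast,
      ENNReal.toReal_natCast] at h1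
    push_cast at h1
    linarith
  · intro n hn
    exact (tendsto_truncatedIntegral (hf_meas n) (hf_pos n hn)).comp
      (tendsto_atTop_mono (fun M => Nat.le_mul_of_pos_right M (by omega)) tendsto_id)

theorem theorem2 {X : Type*} [MeasurableSpace X] (μ : Measure X) [IsProbabilityMeasure μ]
    (T : X → X) (hT : MeasurePreserving T μ μ)
    (f : ℕ → X → EReal) (hf_meas : ∀ n, 1 ≤ n → Measurable (f n))
    (hf_pos : ∀ n, 1 ≤ n → posPartIntegral μ (f n) ≠ ⊤)
    (σ : ℕ → ℕ) (hσ : (fun n => (σ n : ℝ)) =o[atTop] (fun n => (n : ℝ))) (hσ_one : σ 1 = 0)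
    (ρ : ℕ → X → ℝ) (hρ_nonneg : ∀ n, 1 ≤ n → ∀ᵐ x ∂μ, 0 ≤ ρ n x)
    (hρ_int : ∀ n, 1 ≤ n → Integrable (ρ n) μ)
    (hsub : ∀ n m, 1 ≤ n → 1 ≤ m →
      ∀ᵐ x ∂μ, f (n + σ n + m) x ≤ f n x + (ρ n x : EReal) + f m (T^[n + σ n] x))
    (hρ_lim : ∀ᵐ x ∂μ, Tendsto (fun n : ℕ => ρ n x / (n : ℝ)) atTop (𝓝 0))
    (hρ_mean : Tendsto (fun n : ℕ => (∫ x, ρ n x ∂μ) / (n : ℝ)) atTop (𝓝 0)) :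
    ∃ F : X → EReal, Measurable F ∧
      (∀ᵐ x ∂μ, Tendsto (fun n : ℕ => f n x / (n : EReal)) atTop (𝓝 (F x))) ∧
      posPartIntegral μ F ≠ ⊤ ∧
      Tendsto (fun n : ℕ => extIntegral μ (f n) / (n : EReal)) atTop (𝓝 (extIntegral μ F)) := by
  -- The index `0` is unconstrained: put `f 0 = 0`, and take measurable versions of the errors.
  have hver : ∀ n, ∃ r : X → ℝ, Measurable r ∧ (1 ≤ n → ρ n =ᵐ[μ] r) := fun n => by
    by_cases hn : 1 ≤ n
    · exact ⟨_, (hρ_int n hn).1.stronglyMeasurable_mk.measurable, fun _ => (hρ_int n hn).1.ae_eq_mk⟩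
    · exact ⟨0, measurable_zero, fun h => absurd h hn⟩
  choose r hr_meas hr using hver
  have hr_all : ∀ᵐ x ∂μ, ∀ n, 1 ≤ n → ρ n x = r n x :=
    ae_all_iff.2 fun n => by
      by_cases hn : 1 ≤ n
      · filter_upwards [hr n hn] with x hx _ using hx
      · exact .of_forall fun x h => absurd h hn
  have hf' : ∀ n, 1 ≤ n → (if n = 0 then 0 else f n) = f n := fun n hn => if_neg (by omega)
  obtain ⟨F, hF1, hF2, hF3, hF4⟩ := gapped_subadditive_of_measurable hT
    (f := fun n => if n = 0 then 0 else f n) (ρ := r)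
    (fun n => by
      rcases Nat.eq_zero_or_pos n with rfl | hn
      · simpa using measurable_zero
      · simpa only [hf' n hn] using hf_meas n hn)
    (fun n hn => by simpa only [hf' n hn] using hf_pos n hn) hσ hσ_one hr_meas
    (fun n hn => by filter_upwards [hρ_nonneg n hn, hr n hn] with x hx hx' using hx' ▸ hx)
    (fun n hn => (hρ_int n hn).congr (hr n hn))
    (fun n m hn hm => by
      simp only [hf' n hn, hf' m hm, hf' (n + σ n + m) (by omega)]
      filter_upwards [hsub n m hn hm, hr n hn] with x hx hx' using hx' ▸ hx)
    (by
      filter_upwards [hρ_lim, hr_all] with x hx hx'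
      refine hx.congr' ?_
      filter_upwards [eventually_ge_atTop 1] with n hn
      rw [hx' n hn])
    (hρ_mean.congr' (by
      filter_upwards [eventually_ge_atTop 1] with n hn
      rw [integral_congr_ae (hr n hn)]))
  refine ⟨F, hF1, ?_, hF3, hF4.congr' ?_⟩
  · filter_upwards [hF2] with x hx
    refine hx.congr' ?_
    filter_upwards [eventually_ge_atTop 1] with n hn
    simp only [hf' n hn]
  · filter_upwards [eventually_ge_atTop 1] with n hn
    simp only [hf' n hn]
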